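/- Let $d\ge 1$ be an integer, let $0\le\alpha<d$, and let $1<p<\infty$ and $0<q<\infty$ satisfy $\frac1q=\frac1p-\frac{\alpha}{d}$; put $p'=\frac{p}{p-1}$. Cubes are nondegenerate cubes in $\mathbb{R}^d$ with sides parallel to the axes, and $|Q|$ is the Lebesgue measure of $Q$. For a locally integrable $\varphi:\mathbb{R}^d\to\mathbb{R}$ let $$\mathcal{M}^\alpha\varphi(x)=\sup\Big\{|Q|^{\frac{\alpha}{d}-1}\int_Q|\varphi(u)|\,du:\ Q\text{ a cube containing }x\Big\}.$$ A weight is a locally integrable function $w$ on $\mathbb{R}^d$ that is positive almost everywhere; for $1<r<\infty$ put $$[w]_{A_r}=\sup_Q\Big(\frac1{|Q|}\int_Q w\Big)\Big(\frac1{|Q|}\int_Q w^{-1/(r-1)}\Big)^{r-1}\in[0,\infty],$$ the supremum being over all cubes, and call $w$ an $A_r$ weight if $[w]_{A_r}<\infty$. Write $\|f\|_{L^p(w)}=\big(\int_{\mathbb{R}^d}|f|^p w\,du\big)^{1/p}\in[0,\infty]$. Then for every $A_{q/p'+1}$ weight $w$ and every locally integrable $\varphi:\mathbb{R}^d\to\mathbb{R}$,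 $$\|\mathcal{M}^\alpha\varphi\|_{L^q(w)}\le C^d\,\inf_{1<r<q/p'+1}\Big\{[w]_{A_r}^{1/(q-s)}\Big(\frac qs\Big)^{1/(q-s)}\Big\}\,\|\varphi\|_{L^p(w^{p/q})},\qquad s=s(r)=q-\frac{rq^2}{(r-1)(q-p)+pq},$$ with the absolute constant $C=12$. -/

import Mathlib

open MeasureTheory
open scoped ENNReal

noncomputable section

/-- `Q ⊆ ℝ^d` is a (nondegenerate) cube with sides parallel to the axes. -/
def IsCube {d : ℕ} (Q : Set (Fin d → ℝ)) : Prop :=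
  ∃ (a : Fin d → ℝ) (l : ℝ), 0 < l ∧ Q = Set.Icc a (fun i => a i + l)

/-- The fractional maximal operator
`M^α φ(x) = sup { |Q|^(α/d - 1) ∫_Q |φ| : Q a cube containing x }`, with values in `[0, ∞]`. -/
def fracMaximal {d : ℕ} (α : ℝ) (φ : (Fin d → ℝ) → ℝ) (x : Fin d → ℝ) : ℝ≥0∞ :=
  ⨆ (Q : Set (Fin d → ℝ)) (_ : IsCube Q) (_ : x ∈ Q),
    volume Q ^ (α / (d : ℝ) - 1) * ∫⁻ u in Q, ENNReal.ofReal |φ u|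

/-- A weight: a locally integrable function on `ℝ^d` that is positive (almost everywhere). -/
structure IsWeight {d : ℕ} (w : (Fin d → ℝ) → ℝ) : Prop where
  locallyIntegrable : LocallyIntegrable w volume
  pos : ∀ᵐ x ∂volume, 0 < w x

/-- The `A_r` characteristic
`[w]_{A_r} = sup_Q (|Q|⁻¹ ∫_Q w) (|Q|⁻¹ ∫_Q w^(-1/(r-1)))^(r-1)`, with values in `[0, ∞]`. -/
def apChar {d : ℕ} (r : ℝ) (w : (Fin d → ℝ) → ℝ) : ℝ≥0∞ :=
  ⨆ (Q : Set (Fin d → ℝ)) (_ : IsCube Q),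
    ((volume Q)⁻¹ * ∫⁻ x in Q, ENNReal.ofReal (w x)) *
      ((volume Q)⁻¹ * ∫⁻ x in Q, ENNReal.ofReal (w x ^ (-1 / (r - 1)))) ^ (r - 1)

/-- `w` is an `A_r` weight (used for `1 < r < ∞`). -/
def IsApWeight {d : ℕ} (r : ℝ) (w : (Fin d → ℝ) → ℝ) : Prop :=
  IsWeight w ∧ apChar r w < ∞

/-- The norm of `L^p(w)`, that is `(∫ |f|^p w)^(1/p)`, with values in `[0, ∞]`;
the function `f` is real-valued or `[0, ∞]`-valued. -/
def weightedNorm {d : ℕ} {E : Type} [ENorm E] (p : ℝ) (w : (Fin d → ℝ) → ℝ)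
    (f : (Fin d → ℝ) → E) : ℝ≥0∞ :=
  (∫⁻ x, ‖f x‖ₑ ^ p * ENNReal.ofReal (w x)) ^ (1 / p)

/-- The exponent `s = q - r q² / ((r - 1)(q - p) + p q)`. -/
def sExponent (p q r : ℝ) : ℝ :=
  q - r * q ^ 2 / ((r - 1) * (q - p) + p * q)

end

/-!
Put `μ = w dx`, `s = s(r)` and `τ = q / (q - s)`, and write `|φ| = g ^ (τ / p) * w ^ (α / d)`, so
that `∫ g ^ τ dμ` is the `p`-th power of the norm of `φ` in `L^p(w^(p/q))`. On a cube `Q`, Hölder's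
inequality with the four factors `g * w`, `g ^ τ * w`, `w ^ (-1 / (r - 1))` and `1` bounds
`|Q| ^ (α / d - 1) * ∫_Q |φ|` by the product of `[w]_{A_r} ^ (τ / q)`, the `μ`-average of `g` over
`Q` to the power `τ / q`, and `(∫ g ^ τ dμ) ^ (α / d)`; the factor `1` gets a nonnegative exponent
because `r < q / p' + 1`. Every cube lies in a cube of comparable size of one of `2 ^ d` dyadic
grids, at a loss of `6 ^ d`. Doob's inequality in `L^τ(μ)` for the dyadic maximal function of `g`,
whose constant `τ / (τ - 1) = q / s` does not depend on `w`, then gives the bound with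
`2 ^ (d / q) * 6 ^ d ≤ 12 ^ d`.
-/

/-- The maximal function of `g` over the family `D`, with averages taken with respect to `μ`. -/
noncomputable def familyMaximal {X ι : Type*} [MeasurableSpace X] (μ : Measure X) (D : ι → Set X)
    (g : X → ℝ≥0∞) (x : X) : ℝ≥0∞ :=
  ⨆ (i) (_ : x ∈ D i), ⨍⁻ y in D i, g y ∂μ

/-- A family of sets is laminar if any two members are nested or disjoint; dyadic grids are the
example of interest. -/
def IsLaminar {X ι : Type*} (D : ι → Set X) : Prop :=
  ∀ i j, D i ⊆ D j ∨ D j ⊆ D i ∨ Disjoint (D i) (D j)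

section Laminar

variable {X ι : Type*} {D : ι → Set X}

theorem IsLaminar.comp {κ : Type*} (hD : IsLaminar D) (u : κ → ι) : IsLaminar (D ∘ u) :=
  fun i j => hD (u i) (u j)

theorem IsLaminar.exists_pairwiseDisjoint_biUnion_eq (hD : IsLaminar D) (F : Finset ι) :
    ∃ E ⊆ F, (E : Set ι).PairwiseDisjoint D ∧ ⋃ i ∈ E, D i = ⋃ i ∈ F, D i := by
  classical
  induction F using Finset.induction_on with
  | empty => exact ⟨∅, Finset.Subset.rfl, by simp, rfl⟩
  | insert i F _ ih =>
    obtain ⟨E, hEF, hE, hU⟩ := ih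
    by_cases hi : ∃ j ∈ E, D i ⊆ D j
    · obtain ⟨j, hj, hij⟩ := hi
      refine ⟨E, hEF.trans (Finset.subset_insert i F), hE, ?_⟩
      rw [Finset.set_biUnion_insert, ← hU, eq_comm, Set.union_eq_right]
      exact hij.trans (Set.subset_biUnion_of_mem (u := D) (Finset.mem_coe.2 hj))
    · push Not at hi
      refine ⟨insert i (E.filter fun j => Disjoint (D i) (D j)),
        Finset.insert_subset_insert i ((Finset.filter_subset _ _).trans hEF), ?_, ?_⟩
      · rw [Finset.coe_insert]
        refine (hE.subset (Finset.coe_subset.2 (Finset.filter_subset _ _))).insert fun j hj _ => ?_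
        exact (Finset.mem_filter.1 (Finset.mem_coe.1 hj)).2
      · have hsub : ∀ j ∈ E, Disjoint (D i) (D j) ∨ D j ⊆ D i := fun j hj =>
          (hD i j).elim (fun h => absurd h (hi j hj)) Or.symm
        rw [Finset.set_biUnion_insert, Finset.set_biUnion_insert, ← hU]
        refine Set.Subset.antisymm (Set.union_subset_union_right _
          (Set.biUnion_subset_biUnion_left (Finset.filter_subset _ _)))
          (Set.union_subset Set.subset_union_left (Set.iUnion₂_subset fun j hj => ?_))
        rcases hsub j hj with h | h
        · exact (Set.subset_biUnion_of_mem (u := D)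
            (Finset.mem_coe.2 (Finset.mem_filter.2 ⟨hj, h⟩))).trans Set.subset_union_right
        · exact h.trans Set.subset_union_left

variable [MeasurableSpace X] {μ : Measure X} {g : X → ℝ≥0∞}

theorem setOf_lt_familyMaximal (c : ℝ≥0∞) :
    {x | c < familyMaximal μ D g x} = ⋃ i ∈ {i | c < ⨍⁻ y in D i, g y ∂μ}, D i := by
  ext x
  simp only [familyMaximal, Set.mem_ofPred_eq, lt_iSup_iff, Set.mem_iUnion, exists_prop, and_comm]

theorem measurable_familyMaximal [Countable ι] (hm : ∀ i, MeasurableSet (D i)) :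
    Measurable (familyMaximal μ D g) :=
  measurable_of_Ioi fun c => by
    change MeasurableSet {x | c < familyMaximal μ D g x}
    rw [setOf_lt_familyMaximal]
    exact MeasurableSet.biUnion (Set.to_countable _) fun i _ => hm i

theorem familyMaximal_eq_iSup_finset (x : X) :
    familyMaximal μ D g x = ⨆ F : Finset ι, familyMaximal μ (D ∘ ((↑) : F → ι)) g x := by
  simp only [familyMaximal, iSup_subtype, Function.comp_apply]
  exact iSup_eq_iSup_finset _

theorem mul_measure_le_setLIntegral_of_le_setLAverage {c : ℝ≥0∞} {s : Set X} (hs : μ s ≠ ∞)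
    (hc : c ≤ ⨍⁻ x in s, g x ∂μ) : c * μ s ≤ ∫⁻ x in s, g x ∂μ := by
  rw [← measure_mul_setLAverage g hs, mul_comm]
  gcongr

theorem IsLaminar.mul_measure_lt_familyMaximal_le [Finite ι] (hD : IsLaminar D)
    (hm : ∀ i, MeasurableSet (D i)) (hfin : ∀ i, μ (D i) ≠ ∞) (c : ℝ≥0∞) :
    c * μ {x | c < familyMaximal μ D g x} ≤ ∫⁻ x in {x | c < familyMaximal μ D g x}, g x ∂μ := by
  classical
  obtain ⟨E, hEF, hE, hU⟩ := hD.exists_pairwiseDisjoint_biUnion_eq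
    (Set.toFinite {i | c < ⨍⁻ y in D i, g y ∂μ}).toFinset
  simp only [Set.Finite.mem_toFinset] at hU
  rw [setOf_lt_familyMaximal, ← hU, measure_biUnion_finset hE fun i _ => hm i,
    lintegral_biUnion_finset hE fun i _ => hm i, Finset.mul_sum]
  refine Finset.sum_le_sum fun i hi => ?_
  have hci : c < ⨍⁻ y in D i, g y ∂μ := by
    simpa only [Set.Finite.mem_toFinset, Set.mem_ofPred_eq] using hEF hi
  exact mul_measure_le_setLIntegral_of_le_setLAverage (hfin i) hci.le

theorem lintegral_rpow_eq_mul_lintegral_meas_lt {M : X → ℝ≥0∞} (hM : AEMeasurable M μ)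
    (hMfin : ∀ᵐ x ∂μ, M x ≠ ∞) {s : ℝ} (hs : 0 < s) :
    ∫⁻ x, M x ^ s ∂μ = ENNReal.ofReal s *
      ∫⁻ t in Set.Ioi (0 : ℝ), μ {x | ENNReal.ofReal t < M x} * ENNReal.ofReal (t ^ (s - 1)) := by
  have hreal : ∫⁻ x, M x ^ s ∂μ = ∫⁻ x, ENNReal.ofReal ((M x).toReal ^ s) ∂μ := by
    refine lintegral_congr_ae (hMfin.mono fun x hx => ?_)
    dsimp only
    rw [← ENNReal.ofReal_rpow_of_nonneg ENNReal.toReal_nonneg hs.le, ENNReal.ofReal_toReal hx]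
  rw [hreal, lintegral_rpow_eq_lintegral_meas_lt_mul μ
    (.of_forall fun _ => ENNReal.toReal_nonneg) hM.ennreal_toReal hs]
  congr 1
  refine setLIntegral_congr_fun measurableSet_Ioi fun t (ht : 0 < t) => ?_
  congr 1
  refine measure_congr (hMfin.mono fun x hx => propext ?_)
  exact (ENNReal.ofReal_lt_iff_lt_toReal ht.le hx).symm

/-- Summing the weak-type hypothesis over all levels `c` turns it into an inequality of strong
type. -/
theorem lintegral_rpow_le_mul_lintegral_mul_rpow {M : X → ℝ≥0∞} (hM : Measurable M)
    (hMfin : ∀ᵐ x ∂μ, M x ≠ ∞) (hg : AEMeasurable g μ) {τ : ℝ} (hτ : 1 < τ)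
    (hweak : ∀ c, c * μ {x | c < M x} ≤ ∫⁻ x in {x | c < M x}, g x ∂μ) :
    ∫⁻ x, M x ^ τ ∂μ ≤ ENNReal.ofReal (τ / (τ - 1)) * ∫⁻ x, g x * M x ^ (τ - 1) ∂μ := by
  have hτ1 : 0 < τ - 1 := sub_pos.2 hτ
  have hdensity : ∫⁻ x, g x * M x ^ (τ - 1) ∂μ = ∫⁻ x, M x ^ (τ - 1) ∂(μ.withDensity g) :=
    (lintegral_withDensity_eq_lintegral_mul₀ hg (hM.pow_const _).aemeasurable).symm
  rw [hdensity, lintegral_rpow_eq_mul_lintegral_meas_lt hM.aemeasurable hMfin (by linarith),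
    lintegral_rpow_eq_mul_lintegral_meas_lt hM.aemeasurable
      (withDensity_absolutelyContinuous μ g hMfin) hτ1, ← mul_assoc,
    ← ENNReal.ofReal_mul (by positivity), div_mul_cancel₀ _ hτ1.ne']
  gcongr ENNReal.ofReal τ * ?_
  refine setLIntegral_mono' measurableSet_Ioi fun t (ht : 0 < t) => ?_
  rw [withDensity_apply _ (measurableSet_lt measurable_const hM)]
  calc μ {x | ENNReal.ofReal t < M x} * ENNReal.ofReal (t ^ (τ - 1))
      = ENNReal.ofReal t * μ {x | ENNReal.ofReal t < M x} * ENNReal.ofReal (t ^ (τ - 1 - 1)) := by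
        rw [← mul_rotate, ← ENNReal.ofReal_mul (by positivity), ← Real.rpow_add_one ht.ne',
          sub_add_cancel, mul_comm]
    _ ≤ (∫⁻ x in {x | ENNReal.ofReal t < M x}, g x ∂μ) * ENNReal.ofReal (t ^ (τ - 1 - 1)) := by
        gcongr
        exact hweak _

theorem le_rpow_mul_of_le_mul_rpow_mul_rpow {Y K G : ℝ≥0∞} {τ : ℝ} (hτ : 0 < τ) (hY : Y ≠ ∞)
    (h : Y ≤ K * (G ^ (1 / τ) * Y ^ (1 - 1 / τ))) : Y ≤ K ^ τ * G := by
  rcases eq_or_ne Y 0 with rfl | hY0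
  · exact zero_le
  have hroot : Y ^ (1 / τ) ≤ K * G ^ (1 / τ) := by
    rw [← ENNReal.mul_le_mul_iff_left (ENNReal.rpow_pos (pos_iff_ne_zero.2 hY0) hY).ne'
        (ENNReal.rpow_ne_top_of_ne_zero hY0 hY (y := 1 - 1 / τ)),
      ← ENNReal.rpow_add _ _ hY0 hY, add_sub_cancel, ENNReal.rpow_one, mul_assoc]
    exact h
  rw [one_div, ENNReal.rpow_inv_le_iff hτ, ENNReal.mul_rpow_of_nonneg _ _ hτ.le,
    ENNReal.rpow_inv_rpow hτ.ne'] at hroot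
  exact hroot

/-- Finiteness of `∫ M ^ τ` is what allows it to be absorbed after Hölder's inequality. -/
theorem lintegral_rpow_le_of_mul_measure_lt_le {M : X → ℝ≥0∞} (hM : Measurable M)
    (hg : AEMeasurable g μ) {τ : ℝ} (hτ : 1 < τ)
    (hweak : ∀ c, c * μ {x | c < M x} ≤ ∫⁻ x in {x | c < M x}, g x ∂μ)
    (hMτ : ∫⁻ x, M x ^ τ ∂μ ≠ ∞) :
    ∫⁻ x, M x ^ τ ∂μ ≤ ENNReal.ofReal (τ / (τ - 1)) ^ τ * ∫⁻ x, g x ^ τ ∂μ := by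
  have hτ0 : 0 < τ := by linarith
  have hMfin : ∀ᵐ x ∂μ, M x ≠ ∞ := by
    filter_upwards [ae_lt_top (hM.pow_const τ) hMτ] with x hx
    exact fun h => hx.ne (by rw [h, ENNReal.top_rpow_of_pos hτ0])
  have hholder : ∫⁻ x, g x * M x ^ (τ - 1) ∂μ ≤
      (∫⁻ x, g x ^ τ ∂μ) ^ (1 / τ) * (∫⁻ x, M x ^ τ ∂μ) ^ (1 - 1 / τ) := by
    have h := ENNReal.lintegral_mul_norm_pow_le (hg.pow_const τ) (hM.pow_const τ).aemeasurable
      (one_div_nonneg.2 hτ0.le) (sub_nonneg.2 ((div_le_one hτ0).2 hτ.le)) (add_sub_cancel _ _)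
    simpa only [← ENNReal.rpow_mul, mul_sub, mul_one_div_cancel hτ0.ne', mul_one,
      ENNReal.rpow_one] using h
  refine le_rpow_mul_of_le_mul_rpow_mul_rpow hτ0 hMτ ?_
  refine (lintegral_rpow_le_mul_lintegral_mul_rpow hM hMfin hg hτ hweak).trans ?_
  gcongr

theorem setLIntegral_ne_top_of_lintegral_rpow_ne_top {τ : ℝ} (hτ : 1 ≤ τ)
    (hgτ : ∫⁻ x, g x ^ τ ∂μ ≠ ∞) {s : Set X} (hs : μ s ≠ ∞) : ∫⁻ x in s, g x ∂μ ≠ ∞ := by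
  have hpoint : ∀ x, g x ≤ 1 + g x ^ τ := fun x => by
    rcases le_total (g x) 1 with h | h
    · exact h.trans le_self_add
    · exact (ENNReal.le_rpow_self_of_one_le h hτ).trans le_add_self
  refine ne_top_of_le_ne_top ?_ (lintegral_mono hpoint)
  rw [lintegral_add_left measurable_const, setLIntegral_one]
  exact ENNReal.add_ne_top.2 ⟨hs, ne_top_of_le_ne_top hgτ (setLIntegral_le_lintegral _ _)⟩

theorem lintegral_familyMaximal_rpow_ne_top_of_finite [Finite ι] (hm : ∀ i, MeasurableSet (D i))
    (hfin : ∀ i, μ (D i) ≠ ∞) {τ : ℝ} (hτ : 1 ≤ τ)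
    (hgτ : ∫⁻ x, g x ^ τ ∂μ ≠ ∞) : ∫⁻ x, familyMaximal μ D g x ^ τ ∂μ ≠ ∞ := by
  have := Fintype.ofFinite ι
  have hτ0 : 0 < τ := by linarith
  have hpoint : ∀ x, familyMaximal μ D g x ^ τ ≤
      ∑ i, (D i).indicator (fun _ => (⨍⁻ y in D i, g y ∂μ) ^ τ) x := fun x => by
    rw [← ENNReal.le_rpow_inv_iff hτ0]
    refine iSup₂_le fun i hi => ?_
    rw [ENNReal.le_rpow_inv_iff hτ0, ← Set.indicator_of_mem hi fun _ => (⨍⁻ y in D i, g y ∂μ) ^ τ]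
    exact Finset.single_le_sum
      (f := fun i => (D i).indicator (fun _ => (⨍⁻ y in D i, g y ∂μ) ^ τ) x)
      (fun _ _ => zero_le) (Finset.mem_univ i)
  refine ne_top_of_le_ne_top ?_ (lintegral_mono hpoint)
  rw [lintegral_finsetSum _ fun i _ => measurable_const.indicator (hm i)]
  refine ENNReal.sum_ne_top.2 fun i _ => ?_
  rw [lintegral_indicator_const (hm i)]
  exact ENNReal.mul_ne_top (ENNReal.rpow_ne_top_of_nonneg hτ0.le (setLAverage_lt_top
    (setLIntegral_ne_top_of_lintegral_rpow_ne_top hτ hgτ (hfin i))).ne) (hfin i)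

theorem IsLaminar.lintegral_familyMaximal_rpow_le_of_finite [Finite ι] (hD : IsLaminar D)
    (hm : ∀ i, MeasurableSet (D i)) (hfin : ∀ i, μ (D i) ≠ ∞) (hg : AEMeasurable g μ)
    {τ : ℝ} (hτ : 1 < τ) :
    ∫⁻ x, familyMaximal μ D g x ^ τ ∂μ ≤
      ENNReal.ofReal (τ / (τ - 1)) ^ τ * ∫⁻ x, g x ^ τ ∂μ := by
  rcases eq_or_ne (∫⁻ x, g x ^ τ ∂μ) ∞ with hgτ | hgτ
  · have hconst : 0 < ENNReal.ofReal (τ / (τ - 1)) :=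
      ENNReal.ofReal_pos.2 (div_pos (by linarith) (by linarith))
    rw [hgτ, ENNReal.mul_top (ENNReal.rpow_pos hconst ENNReal.ofReal_ne_top).ne']
    exact le_top
  · exact lintegral_rpow_le_of_mul_measure_lt_le (measurable_familyMaximal hm) hg hτ
      (hD.mul_measure_lt_familyMaximal_le hm hfin)
      (lintegral_familyMaximal_rpow_ne_top_of_finite hm hfin hτ.le hgτ)

theorem IsLaminar.lintegral_familyMaximal_rpow_le [Countable ι] (hD : IsLaminar D)
    (hm : ∀ i, MeasurableSet (D i)) (hfin : ∀ i, μ (D i) ≠ ∞) (hg : AEMeasurable g μ)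
    {τ : ℝ} (hτ : 1 < τ) :
    ∫⁻ x, familyMaximal μ D g x ^ τ ∂μ ≤
      ENNReal.ofReal (τ / (τ - 1)) ^ τ * ∫⁻ x, g x ^ τ ∂μ := by
  have hτ0 : 0 < τ := by linarith
  have hsup : ∀ x, familyMaximal μ D g x ^ τ =
      ⨆ F : Finset ι, familyMaximal μ (D ∘ ((↑) : F → ι)) g x ^ τ := fun x => by
    rw [familyMaximal_eq_iSup_finset]
    exact (ENNReal.orderIsoRpow τ hτ0).map_iSup _
  simp only [hsup]
  rw [lintegral_iSup_directed]
  · exact iSup_le fun F => (hD.comp ((↑) : F → ι)).lintegral_familyMaximal_rpow_le_of_finite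
      (fun i => hm i) (fun i => hfin i) hg hτ
  · exact fun F => ((measurable_familyMaximal fun i : F => hm i).pow_const τ).aemeasurable
  · refine Monotone.directed_le fun F F' h x => ENNReal.rpow_le_rpow ?_ hτ0.le
    exact iSup₂_le fun i hi => le_iSup₂_of_le (⟨i, h i.2⟩ : F') hi le_rfl

end Laminar

section Grid

/-- The shift, relative to the side length `2 ^ k`, of the `k`-th generation of the standard dyadic
grid (`b = false`) and of its one-third translate (`b = true`). The sign alternates with `k` so that
consecutive generations of the translated grid are nested. -/
noncomputable def gridShift (b : Bool) (k : ℤ) : ℝ :=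
  if b then (k.negOnePow : ℤ) / 3 else 0

/-- The index of the `k`-th generation dyadic interval containing `x`. -/
noncomputable def gridIndex (b : Bool) (k : ℤ) (x : ℝ) : ℤ :=
  ⌊x / 2 ^ k - gridShift b k⌋

variable {d : ℕ}

/-- The dyadic cube of generation `j.1` and position `j.2`, in the grid that is translated in the
coordinates `i` with `δ i = true`. -/
def gridCube (δ : Fin d → Bool) (j : ℤ × (Fin d → ℤ)) : Set (Fin d → ℝ) :=
  {x | ∀ i, gridIndex (δ i) j.1 (x i) = j.2 i}

theorem exists_int_eq_gridShift_sub (b : Bool) (k : ℤ) :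
    ∃ e : ℤ, (e : ℝ) = gridShift b k - 2 * gridShift b (k + 1) := by
  cases b with
  | false => exact ⟨0, by simp [gridShift]⟩
  | true =>
    refine ⟨k.negOnePow, ?_⟩
    simp only [gridShift, if_true, Int.negOnePow_succ, Units.val_neg, Int.cast_neg]
    ring

theorem exists_gridIndex_succ (b : Bool) (k : ℤ) :
    ∃ e : ℤ, ∀ x, gridIndex b (k + 1) x = (gridIndex b k x + e) / 2 := by
  obtain ⟨e, he⟩ := exists_int_eq_gridShift_sub b k
  refine ⟨e, fun x => ?_⟩
  have hhalf : x / 2 ^ (k + 1) - gridShift b (k + 1) =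
      (x / 2 ^ k - gridShift b k + e) / (2 : ℕ) := by
    rw [he, zpow_add_one₀ two_ne_zero]
    push_cast
    field_simp
    ring
  rw [gridIndex, hhalf, Int.floor_div_natCast, Int.floor_add_intCast]
  rfl

theorem gridIndex_eq_of_le {b : Bool} {j k : ℤ} (hjk : j ≤ k) {x y : ℝ}
    (h : gridIndex b j x = gridIndex b j y) : gridIndex b k x = gridIndex b k y := by
  induction k, hjk using Int.leInduction with
  | base => exact h
  | succ k _ ih =>
    obtain ⟨e, he⟩ := exists_gridIndex_succ b k
    rw [he, he, ih]

theorem gridCube_subset_or_disjoint (δ : Fin d → Bool) {i j : ℤ × (Fin d → ℤ)}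
    (h : i.1 ≤ j.1) : gridCube δ i ⊆ gridCube δ j ∨ Disjoint (gridCube δ i) (gridCube δ j) := by
  refine or_iff_not_imp_right.2 fun hmeet y hy l => ?_
  obtain ⟨x, hxi, hxj⟩ := Set.not_disjoint_iff.1 hmeet
  rw [← hxj l]
  exact gridIndex_eq_of_le h ((hy l).trans (hxi l).symm)

theorem isLaminar_gridCube (δ : Fin d → Bool) : IsLaminar (gridCube δ) := by
  intro i j
  rcases le_total i.1 j.1 with h | h
  · exact (gridCube_subset_or_disjoint δ h).imp_right Or.inr
  · exact Or.inr ((gridCube_subset_or_disjoint δ h).imp_right fun h => h.symm)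

theorem gridCube_eq_pi (δ : Fin d → Bool) (j : ℤ × (Fin d → ℤ)) :
    gridCube δ j = Set.univ.pi fun i =>
      Set.Ico (2 ^ j.1 * (j.2 i + gridShift (δ i) j.1))
        (2 ^ j.1 * (j.2 i + gridShift (δ i) j.1) + 2 ^ j.1) := by
  have hside : (0 : ℝ) < 2 ^ j.1 := by positivity
  ext x
  simp only [gridCube, gridIndex, Int.floor_eq_iff, Set.mem_ofPred_eq, Set.mem_univ_pi, Set.mem_Ico]
  refine forall_congr' fun i => and_congr ?_ ?_
  · rw [le_sub_iff_add_le, le_div_iff₀' hside]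
  · rw [sub_lt_iff_lt_add, div_lt_iff₀' hside, add_right_comm, mul_add_one]

theorem measurableSet_gridCube (δ : Fin d → Bool) (j : ℤ × (Fin d → ℤ)) :
    MeasurableSet (gridCube δ j) := by
  rw [gridCube_eq_pi]
  exact MeasurableSet.univ_pi fun i => measurableSet_Ico

theorem exists_isCube_gridCube_ae_eq (δ : Fin d → Bool) (j : ℤ × (Fin d → ℤ)) :
    ∃ Q, IsCube Q ∧ gridCube δ j =ᵐ[volume] Q := by
  refine ⟨_, ⟨fun i => 2 ^ j.1 * (j.2 i + gridShift (δ i) j.1), 2 ^ j.1, by positivity, rfl⟩, ?_⟩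
  rw [gridCube_eq_pi]
  exact Measure.univ_pi_Ico_ae_eq_Icc

theorem volume_gridCube (δ : Fin d → Bool) (j : ℤ × (Fin d → ℤ)) :
    volume (gridCube δ j) = ENNReal.ofReal (2 ^ j.1) ^ d := by
  rw [gridCube_eq_pi, Real.volume_pi_Ico]
  simp only [add_sub_cancel_left, Finset.prod_const, Finset.card_univ, Fintype.card_fin]

theorem exists_int_add_gridShift_mem_Ioo {b : Bool} {k : ℤ} {a l x : ℝ} (hl : 3 * l < 2 ^ k)
    (hx : x ∈ Set.Icc a (a + l)) (hne : gridIndex b k x ≠ gridIndex b k a) :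
    ∃ n : ℤ, n + gridShift b k ∈ Set.Ioo (a / 2 ^ k) (a / 2 ^ k + 1 / 3) := by
  have hside : (0 : ℝ) < 2 ^ k := by positivity
  have hax : a / 2 ^ k ≤ x / 2 ^ k := by
    gcongr
    exact hx.1
  have hxa : x / 2 ^ k < a / 2 ^ k + 1 / 3 := by
    rw [div_add' _ _ _ hside.ne', div_lt_div_iff_of_pos_right hside]
    linarith [hx.2]
  have hlt : gridIndex b k a < gridIndex b k x :=
    (Int.floor_le_floor (by linarith)).lt_of_ne hne.symm
  have hfloor : (gridIndex b k x : ℝ) ≤ x / 2 ^ k - gridShift b k := Int.floor_le _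
  exact ⟨gridIndex b k x, by linarith [Int.floor_lt.1 hlt], by linarith⟩

theorem exists_gridIndex_eq_of_mem_Icc {a l : ℝ} {k : ℤ} (hl : 3 * l < 2 ^ k) :
    ∃ b, ∀ x ∈ Set.Icc a (a + l), gridIndex b k x = gridIndex b k a := by
  by_contra! hcross
  obtain ⟨x, hx, hxne⟩ := hcross false
  obtain ⟨y, hy, hyne⟩ := hcross true
  obtain ⟨m, hm₁, hm₂⟩ := exists_int_add_gridShift_mem_Ioo hl hx hxne
  obtain ⟨n, hn₁, hn₂⟩ := exists_int_add_gridShift_mem_Ioo hl hy hyne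
  simp only [gridShift, Bool.false_eq_true, if_false, if_true] at hm₁ hm₂ hn₁ hn₂
  -- The grid points `m` and `n ± 1 / 3` would be less than `1 / 3` apart.
  have hlow : -1 < 3 * (n - m) + (k.negOnePow : ℤ) := by
    exact_mod_cast (by linarith : (-1 : ℝ) < 3 * (n - m) + (k.negOnePow : ℤ))
  have hupp : 3 * (n - m) + (k.negOnePow : ℤ) < 1 := by
    exact_mod_cast (by linarith : 3 * (n - m) + ((k.negOnePow : ℤ) : ℝ) < 1)
  rcases Int.units_eq_one_or k.negOnePow with h | h <;>
    simp only [h, Units.val_one, Units.val_neg] at hlow hupp <;> omega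

/-- The one-third trick: in each coordinate, one of the two grids does not cut the side of `Q`. -/
theorem IsCube.exists_subset_gridCube {Q : Set (Fin d → ℝ)} (hQ : IsCube Q) :
    ∃ δ j, Q ⊆ gridCube δ j ∧ volume (gridCube δ j) ≤ 6 ^ d * volume Q := by
  obtain ⟨a, l, hl, rfl⟩ := hQ
  obtain ⟨n, hn, hn'⟩ :=
    exists_mem_Ico_zpow (x := 3 * l) (y := (2 : ℝ)) (by positivity) one_lt_two
  choose δ hδ using fun i => exists_gridIndex_eq_of_mem_Icc (a := a i) hn'
  refine ⟨δ, (n + 1, fun i => gridIndex (δ i) (n + 1) (a i)),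
    fun x hx i => hδ i (x i) ⟨hx.1 i, hx.2 i⟩, ?_⟩
  have hside : ENNReal.ofReal (2 ^ (n + 1)) ≤ 6 * ENNReal.ofReal l := by
    rw [← ENNReal.ofReal_ofNat, ← ENNReal.ofReal_mul (by norm_num), zpow_add_one₀ two_ne_zero]
    exact ENNReal.ofReal_le_ofReal (by linarith)
  rw [volume_gridCube, Real.volume_Icc_pi]
  simp only [add_sub_cancel_left, Finset.prod_const, Finset.card_univ, Fintype.card_fin]
  rw [← mul_pow]
  gcongr

end Grid

section Holder

variable {X : Type*} [MeasurableSpace X] {ν : Measure X} {g W : X → ℝ≥0∞}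

theorem rpow_mul_rpow_eq_mul_mul {x y : ℝ≥0∞} (hy0 : y ≠ 0) (hy : y ≠ ∞) {a e r τ : ℝ} (ha : 0 ≤ a)
    (he : 0 ≤ e) (hr : r ≠ 1) (hτ : 0 ≤ τ) :
    x ^ (e + τ * a) * y ^ a =
      (x * y) ^ e * (x ^ τ * y) ^ a * (y ^ (-1 / (r - 1))) ^ ((r - 1) * e) := by
  have hexp : -1 / (r - 1) * ((r - 1) * e) = -e := by
    field_simp [sub_ne_zero.2 hr]
  rw [ENNReal.mul_rpow_of_nonneg _ _ he, ENNReal.mul_rpow_of_nonneg _ _ ha, ← ENNReal.rpow_mul,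
    ← ENNReal.rpow_mul, hexp, ENNReal.rpow_add_of_nonneg _ _ he (mul_nonneg hτ ha)]
  calc x ^ e * x ^ (τ * a) * y ^ a = x ^ e * x ^ (τ * a) * y ^ a * (y ^ e * y ^ (-e)) := by
        rw [← ENNReal.rpow_add _ _ hy0 hy, add_neg_cancel, ENNReal.rpow_zero, mul_one]
    _ = _ := by ring

theorem lintegral_rpow_mul_rpow_le (hg : AEMeasurable g ν) (hW : AEMeasurable W ν)
    (hW0 : ∀ᵐ x ∂ν, W x ≠ 0) (hWt : ∀ᵐ x ∂ν, W x ≠ ∞) {a e r τ : ℝ} (ha : 0 ≤ a) (he : 0 ≤ e)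
    (hr : 1 < r) (hτ : 0 ≤ τ) (hsum : r * e + a ≤ 1) :
    ∫⁻ x, g x ^ (e + τ * a) * W x ^ a ∂ν ≤
      (∫⁻ x, g x * W x ∂ν) ^ e * (∫⁻ x, g x ^ τ * W x ∂ν) ^ a *
        (∫⁻ x, W x ^ (-1 / (r - 1)) ∂ν) ^ ((r - 1) * e) * ν Set.univ ^ (1 - (r * e + a)) := by
  have hholder := ENNReal.lintegral_prod_norm_pow_le (μ := ν) Finset.univ
    (f := ![fun x => g x * W x, fun x => g x ^ τ * W x, fun x => W x ^ (-1 / (r - 1)), fun _ => 1])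
    (by
      rintro i -
      fin_cases i
      exacts [hg.mul hW, (hg.pow_const τ).mul hW, hW.pow_const _, aemeasurable_const])
    (p := ![e, a, (r - 1) * e, 1 - (r * e + a)])
    (by simp only [Fin.sum_univ_four, Matrix.cons_val]; ring)
    (by
      rintro i -
      fin_cases i
      exacts [he, ha, mul_nonneg (sub_nonneg.2 hr.le) he, sub_nonneg.2 hsum])
  simp only [Fin.prod_univ_four, Matrix.cons_val, lintegral_one, ENNReal.one_rpow,
    mul_one] at hholder
  refine (lintegral_mono_ae ?_).trans hholder
  filter_upwards [hW0, hWt] with x hx0 hxt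
  exact (rpow_mul_rpow_eq_mul_mul hx0 hxt ha he hr.ne' hτ).le

theorem rpow_mul_holder_bound_eq {V S I G Z : ℝ≥0∞} (hV0 : V ≠ 0) (hV : V ≠ ∞) (hS0 : S ≠ 0)
    (hS : S ≠ ∞) {a e r : ℝ} (he : 0 ≤ e) (hr : 1 ≤ r) :
    V ^ (a - 1) * (I ^ e * G ^ a * Z ^ ((r - 1) * e) * V ^ (1 - (r * e + a))) =
      ((V⁻¹ * S) * (V⁻¹ * Z) ^ (r - 1)) ^ e * (S⁻¹ * I) ^ e * G ^ a := by
  have hr1 : 0 ≤ r - 1 := sub_nonneg.2 hr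
  have hVexp : V ^ (a - 1) * V ^ (1 - (r * e + a)) = V ^ (-e) * V ^ (-((r - 1) * e)) := by
    rw [← ENNReal.rpow_add _ _ hV0 hV, ← ENNReal.rpow_add _ _ hV0 hV]
    ring_nf
  have hSexp : S ^ e * S ^ (-e) = 1 := by
    rw [← ENNReal.rpow_add _ _ hS0 hS, add_neg_cancel, ENNReal.rpow_zero]
  simp only [ENNReal.mul_rpow_of_nonneg _ _ he, ENNReal.mul_rpow_of_nonneg _ _ hr1,
    ENNReal.inv_rpow, ← ENNReal.rpow_neg, ← ENNReal.rpow_mul]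
  calc V ^ (a - 1) * (I ^ e * G ^ a * Z ^ ((r - 1) * e) * V ^ (1 - (r * e + a)))
      = V ^ (a - 1) * V ^ (1 - (r * e + a)) * I ^ e * G ^ a * Z ^ ((r - 1) * e) *
          (S ^ e * S ^ (-e)) := by rw [hSexp]; ring
    _ = _ := by rw [hVexp, neg_mul]; ring

end Holder

section Weight

variable {d : ℕ} {Q : Set (Fin d → ℝ)} {w : (Fin d → ℝ) → ℝ}

theorem IsCube.isCompact (hQ : IsCube Q) : IsCompact Q := by
  obtain ⟨a, l, -, rfl⟩ := hQ
  exact isCompact_Icc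

theorem IsCube.volume_ne_zero (hQ : IsCube Q) : volume Q ≠ 0 := by
  obtain ⟨a, l, hl, rfl⟩ := hQ
  simp [Real.volume_Icc_pi, hl]

/-- The measure `w dx`. -/
noncomputable def weightMeasure (w : (Fin d → ℝ) → ℝ) : Measure (Fin d → ℝ) :=
  volume.withDensity fun x => ENNReal.ofReal (w x)

theorem IsWeight.aemeasurable_ofReal (hw : IsWeight w) :
    AEMeasurable fun x => ENNReal.ofReal (w x) :=
  hw.locallyIntegrable.aestronglyMeasurable.aemeasurable.ennreal_ofReal

theorem IsWeight.ofReal_ne_zero (hw : IsWeight w) : ∀ᵐ x, ENNReal.ofReal (w x) ≠ 0 :=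
  hw.pos.mono fun _ hx => (ENNReal.ofReal_pos.2 hx).ne'

theorem weightMeasure_absolutelyContinuous : weightMeasure w ≪ volume :=
  withDensity_absolutelyContinuous _ _

theorem weightMeasure_apply (w : (Fin d → ℝ) → ℝ) (Q : Set (Fin d → ℝ)) :
    weightMeasure w Q = ∫⁻ x in Q, ENNReal.ofReal (w x) :=
  withDensity_apply' _ _

theorem IsWeight.weightMeasure_ne_top (hw : IsWeight w) (hQ : IsCompact Q) :
    weightMeasure w Q ≠ ∞ := by
  rw [weightMeasure_apply]
  exact (hw.locallyIntegrable.integrableOn_isCompact hQ).lintegral_lt_top.ne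

theorem IsWeight.weightMeasure_ne_zero (hw : IsWeight w) (hQ : volume Q ≠ 0) :
    weightMeasure w Q ≠ 0 := fun h =>
  hQ (withDensity_absolutelyContinuous' hw.aemeasurable_ofReal hw.ofReal_ne_zero h)

theorem IsWeight.lintegral_weightMeasure (hw : IsWeight w) (f : (Fin d → ℝ) → ℝ≥0∞) :
    ∫⁻ x, f x ∂weightMeasure w = ∫⁻ x, f x * ENNReal.ofReal (w x) := by
  rw [weightMeasure, lintegral_withDensity_eq_lintegral_mul_non_measurable₀ _
    hw.aemeasurable_ofReal (.of_forall fun _ => ENNReal.ofReal_lt_top)]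
  simp only [Pi.mul_apply, mul_comm]

theorem IsWeight.setLIntegral_weightMeasure (hw : IsWeight w) (f : (Fin d → ℝ) → ℝ≥0∞)
    (Q : Set (Fin d → ℝ)) :
    ∫⁻ x in Q, f x ∂weightMeasure w = ∫⁻ x in Q, f x * ENNReal.ofReal (w x) := by
  rw [weightMeasure, setLIntegral_withDensity_eq_setLIntegral_mul_non_measurable₀' _ _
    hw.aemeasurable_ofReal.restrict _ (.of_forall fun _ => ENNReal.ofReal_lt_top)]
  simp only [Pi.mul_apply, mul_comm]

theorem IsWeight.weightMeasure_gridCube_ne_top (hw : IsWeight w) (δ : Fin d → Bool)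
    (j : ℤ × (Fin d → ℤ)) : weightMeasure w (gridCube δ j) ≠ ∞ := by
  obtain ⟨R, hR, hjR⟩ := exists_isCube_gridCube_ae_eq δ j
  rw [measure_congr (weightMeasure_absolutelyContinuous.ae_eq hjR)]
  exact hw.weightMeasure_ne_top hR.isCompact

theorem IsWeight.average_mul_average_rpow_le (hw : IsWeight w) (r : ℝ) (hQ : IsCube Q) :
    ((volume Q)⁻¹ * weightMeasure w Q) *
      ((volume Q)⁻¹ * ∫⁻ x in Q, ENNReal.ofReal (w x) ^ (-1 / (r - 1))) ^ (r - 1) ≤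
        apChar r w := by
  have hrpow : ∀ᵐ x, ENNReal.ofReal (w x) ^ (-1 / (r - 1)) =
      ENNReal.ofReal (w x ^ (-1 / (r - 1))) :=
    hw.pos.mono fun x hx => ENNReal.ofReal_rpow_of_pos hx
  rw [lintegral_congr_ae (ae_restrict_of_ae hrpow), weightMeasure_apply]
  exact le_iSup₂_of_le Q hQ le_rfl

theorem IsWeight.one_le_apChar (hw : IsWeight w) {r : ℝ} (hr : 1 < r) : 1 ≤ apChar r w := by
  have hQ : IsCube (Set.Icc (0 : Fin d → ℝ) fun i => (0 : Fin d → ℝ) i + 1) :=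
    ⟨0, 1, one_pos, rfl⟩
  refine le_trans ?_ (hw.average_mul_average_rpow_le r hQ)
  set Q := Set.Icc (0 : Fin d → ℝ) fun i => (0 : Fin d → ℝ) i + 1
  have hvol : volume Q = 1 := by rw [Real.volume_Icc_pi]; simp
  have hr0 : 0 < r := by linarith
  have hholder := lintegral_rpow_mul_rpow_le (ν := volume.restrict Q) (g := fun _ => 1)
    aemeasurable_const hw.aemeasurable_ofReal.restrict (ae_restrict_of_ae hw.ofReal_ne_zero)
    (.of_forall fun _ => ENNReal.ofReal_ne_top) le_rfl (one_div_nonneg.2 hr0.le) hr zero_le_one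
    (by rw [mul_one_div_cancel hr0.ne', add_zero])
  simp only [ENNReal.one_rpow, ENNReal.rpow_zero, mul_one, one_mul, lintegral_one,
    Measure.restrict_apply_univ, hvol, ← weightMeasure_apply, mul_one_div, inv_one] at hholder ⊢
  have hpow := ENNReal.rpow_le_rpow hholder hr0.le
  rwa [ENNReal.one_rpow, ENNReal.mul_rpow_of_nonneg _ _ hr0.le, ← ENNReal.rpow_mul,
    ← ENNReal.rpow_mul, div_mul_cancel₀ _ hr0.ne', div_mul_cancel₀ _ hr0.ne', ENNReal.rpow_one]
    at hpow

end Weight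

section CubeEstimate

variable {d : ℕ} {w : (Fin d → ℝ) → ℝ} {g : (Fin d → ℝ) → ℝ≥0∞} {a e r τ : ℝ}

theorem IsWeight.rpow_mul_setLIntegral_cube_le (hw : IsWeight w) (hg : AEMeasurable g)
    (ha : 0 ≤ a) (he : 0 ≤ e) (hr : 1 < r) (hτ : 0 ≤ τ) (hsum : r * e + a ≤ 1)
    {Q : Set (Fin d → ℝ)} (hQ : IsCube Q) :
    volume Q ^ (a - 1) * ∫⁻ x in Q, g x ^ (e + τ * a) * ENNReal.ofReal (w x) ^ a ≤
      apChar r w ^ e * (⨍⁻ x in Q, g x ∂weightMeasure w) ^ e *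
        (∫⁻ x, g x ^ τ ∂weightMeasure w) ^ a := by
  have hvol : volume Q ≠ ∞ := hQ.isCompact.measure_ne_top
  have hholder := lintegral_rpow_mul_rpow_le hg.restrict hw.aemeasurable_ofReal.restrict
    (ae_restrict_of_ae hw.ofReal_ne_zero) (.of_forall fun _ => ENNReal.ofReal_ne_top)
    ha he hr hτ hsum (ν := volume.restrict Q)
  rw [Measure.restrict_apply_univ, ← hw.setLIntegral_weightMeasure,
    ← hw.setLIntegral_weightMeasure] at hholder
  calc _ ≤ _ := by gcongr
    _ = _ := rpow_mul_holder_bound_eq hQ.volume_ne_zero hvol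
        (hw.weightMeasure_ne_zero hQ.volume_ne_zero) (hw.weightMeasure_ne_top hQ.isCompact) he hr.le
    _ ≤ _ := by
        rw [setLAverage_eq, ENNReal.div_eq_inv_mul]
        gcongr
        · exact hw.average_mul_average_rpow_le r hQ
        · exact Measure.restrict_le_self

theorem IsWeight.rpow_mul_setLIntegral_gridCube_le (hw : IsWeight w) (hg : AEMeasurable g)
    (ha : 0 ≤ a) (he : 0 ≤ e) (hr : 1 < r) (hτ : 0 ≤ τ) (hsum : r * e + a ≤ 1)
    (δ : Fin d → Bool) (j : ℤ × (Fin d → ℤ)) :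
    volume (gridCube δ j) ^ (a - 1) *
        ∫⁻ x in gridCube δ j, g x ^ (e + τ * a) * ENNReal.ofReal (w x) ^ a ≤
      apChar r w ^ e * (⨍⁻ x in gridCube δ j, g x ∂weightMeasure w) ^ e *
        (∫⁻ x, g x ^ τ ∂weightMeasure w) ^ a := by
  obtain ⟨R, hR, hjR⟩ := exists_isCube_gridCube_ae_eq δ j
  rw [measure_congr hjR, Measure.restrict_congr_set hjR,
    Measure.restrict_congr_set (weightMeasure_absolutelyContinuous.ae_eq hjR)]
  exact hw.rpow_mul_setLIntegral_cube_le hg ha he hr hτ hsum hR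

theorem rpow_sub_one_le_mul_rpow_sub_one {U V C : ℝ≥0∞} (hC : 1 ≤ C) (hCt : C ≠ ∞)
    (hUV : U ≤ C * V) (ha : 0 ≤ a) (ha1 : a ≤ 1) : V ^ (a - 1) ≤ C * U ^ (a - 1) := by
  have hpow : U ^ (1 - a) ≤ C * V ^ (1 - a) := by
    calc U ^ (1 - a) ≤ (C * V) ^ (1 - a) := ENNReal.rpow_le_rpow hUV (sub_nonneg.2 ha1)
      _ = C ^ (1 - a) * V ^ (1 - a) := ENNReal.mul_rpow_of_nonneg _ _ (sub_nonneg.2 ha1)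
      _ ≤ C ^ (1 : ℝ) * V ^ (1 - a) := by
          gcongr
          exact sub_le_self 1 ha
      _ = C * V ^ (1 - a) := by rw [ENNReal.rpow_one]
  have hC0 : C ≠ 0 := (one_pos.trans_le hC).ne'
  rw [← neg_sub 1 a, ENNReal.rpow_neg, ENNReal.rpow_neg]
  calc (V ^ (1 - a))⁻¹ = C * (C * V ^ (1 - a))⁻¹ := by
        rw [ENNReal.mul_inv (.inl hC0) (.inl hCt), ← mul_assoc, ENNReal.mul_inv_cancel hC0 hCt,
          one_mul]
    _ ≤ C * (U ^ (1 - a))⁻¹ := by gcongr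

theorem IsWeight.fracMaximal_le_iSup_familyMaximal (hw : IsWeight w) (hg : AEMeasurable g)
    {α : ℝ} {φ : (Fin d → ℝ) → ℝ}
    (hφ : ∀ᵐ x, ENNReal.ofReal |φ x| = g x ^ (e + τ * (α / d)) * ENNReal.ofReal (w x) ^ (α / d))
    (hα : 0 ≤ α / d) (he : 0 ≤ e) (hr : 1 < r) (hτ : 0 ≤ τ) (hsum : r * e + α / d ≤ 1)
    (x : Fin d → ℝ) :
    fracMaximal α φ x ≤ ⨆ δ : Fin d → Bool,
      6 ^ d * (apChar r w ^ e * (∫⁻ y, g y ^ τ ∂weightMeasure w) ^ (α / d)) *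
        familyMaximal (weightMeasure w) (gridCube δ) g x ^ e := by
  refine iSup_le fun Q => iSup₂_le fun hQ hx => ?_
  obtain ⟨δ, j, hQj, hvol⟩ := hQ.exists_subset_gridCube
  refine le_iSup_of_le δ ?_
  have hα1 : α / d ≤ 1 := by nlinarith
  have hscale := rpow_sub_one_le_mul_rpow_sub_one (one_le_pow₀ (by norm_num))
    (ENNReal.pow_ne_top (by norm_num)) hvol hα hα1
  calc volume Q ^ (α / d - 1) * ∫⁻ u in Q, ENNReal.ofReal |φ u|
      ≤ 6 ^ d * volume (gridCube δ j) ^ (α / d - 1) *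
          ∫⁻ u in gridCube δ j, ENNReal.ofReal |φ u| := by gcongr
    _ = 6 ^ d * (volume (gridCube δ j) ^ (α / d - 1) * ∫⁻ u in gridCube δ j,
          g u ^ (e + τ * (α / d)) * ENNReal.ofReal (w u) ^ (α / d)) := by
        rw [mul_assoc, lintegral_congr_ae (ae_restrict_of_ae hφ)]
    _ ≤ 6 ^ d * (apChar r w ^ e * (⨍⁻ y in gridCube δ j, g y ∂weightMeasure w) ^ e *
          (∫⁻ y, g y ^ τ ∂weightMeasure w) ^ (α / d)) := by
        gcongr 6 ^ d * ?_
        exact hw.rpow_mul_setLIntegral_gridCube_le hg hα he hr hτ hsum δ j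
    _ ≤ 6 ^ d * (apChar r w ^ e * familyMaximal (weightMeasure w) (gridCube δ) g x ^ e *
          (∫⁻ y, g y ^ τ ∂weightMeasure w) ^ (α / d)) := by
        gcongr
        exact le_iSup₂_of_le j (hQj hx) le_rfl
    _ = _ := by ring

end CubeEstimate

section StrongType

variable {d : ℕ} {w φ : (Fin d → ℝ) → ℝ}

theorem lintegral_iSup_rpow_le_sum {X ι : Type*} [MeasurableSpace X] {μ : Measure X} [Fintype ι]
    {f : ι → X → ℝ≥0∞} (hf : ∀ i, Measurable (f i)) {q : ℝ} (hq : 0 < q) :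
    ∫⁻ x, (⨆ i, f i x) ^ q ∂μ ≤ ∑ i, ∫⁻ x, f i x ^ q ∂μ := by
  rw [← lintegral_finsetSum _ fun i _ => (hf i).pow_const q]
  refine lintegral_mono fun x => ?_
  calc (⨆ i, f i x) ^ q = ⨆ i, f i x ^ q := (ENNReal.orderIsoRpow q hq).map_iSup _
    _ ≤ ∑ i, f i x ^ q := iSup_le fun i =>
        Finset.single_le_sum (f := fun i => f i x ^ q) (fun _ _ => zero_le) (Finset.mem_univ i)

theorem IsWeight.lintegral_fracMaximal_rpow_le (hw : IsWeight w) {g : (Fin d → ℝ) → ℝ≥0∞}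
    (hg : AEMeasurable g) {α q r τ : ℝ}
    (hφ : ∀ᵐ x, ENNReal.ofReal |φ x| =
      g x ^ (τ / q + τ * (α / d)) * ENNReal.ofReal (w x) ^ (α / d))
    (hα : 0 ≤ α / d) (hq : 0 < q) (hr : 1 < r) (hτ : 1 < τ) (hsum : r * (τ / q) + α / d ≤ 1) :
    ∫⁻ x, fracMaximal α φ x ^ q ∂weightMeasure w ≤
      2 ^ d * ((6 ^ d * (apChar r w ^ (τ / q) *
        (∫⁻ x, g x ^ τ ∂weightMeasure w) ^ (α / d))) ^ q *
          (ENNReal.ofReal (τ / (τ - 1)) ^ τ * ∫⁻ x, g x ^ τ ∂weightMeasure w)) := by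
  have hτ0 : 0 < τ := by linarith
  set K := 6 ^ d * (apChar r w ^ (τ / q) * (∫⁻ x, g x ^ τ ∂weightMeasure w) ^ (α / d))
  have hmeas : ∀ δ : Fin d → Bool,
      Measurable (familyMaximal (weightMeasure w) (gridCube δ) g) := fun δ =>
    measurable_familyMaximal (measurableSet_gridCube δ)
  have hdoob : ∀ δ : Fin d → Bool,
      ∫⁻ x, familyMaximal (weightMeasure w) (gridCube δ) g x ^ τ ∂weightMeasure w ≤
        ENNReal.ofReal (τ / (τ - 1)) ^ τ * ∫⁻ x, g x ^ τ ∂weightMeasure w := fun δ =>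
    (isLaminar_gridCube δ).lintegral_familyMaximal_rpow_le (measurableSet_gridCube δ)
      (hw.weightMeasure_gridCube_ne_top δ) (hg.mono_ac weightMeasure_absolutelyContinuous) hτ
  calc ∫⁻ x, fracMaximal α φ x ^ q ∂weightMeasure w
      ≤ ∫⁻ x, (⨆ δ, K * familyMaximal (weightMeasure w) (gridCube δ) g x ^ (τ / q)) ^ q
          ∂weightMeasure w := by
        gcongr with x
        exact hw.fracMaximal_le_iSup_familyMaximal hg hφ hα (by positivity) hr hτ0.le hsum x
    _ ≤ ∑ δ, ∫⁻ x, (K * familyMaximal (weightMeasure w) (gridCube δ) g x ^ (τ / q)) ^ q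
          ∂weightMeasure w :=
        lintegral_iSup_rpow_le_sum (fun δ => ((hmeas δ).pow_const _).const_mul K) hq
    _ = ∑ δ, K ^ q * ∫⁻ x, familyMaximal (weightMeasure w) (gridCube δ) g x ^ τ
          ∂weightMeasure w := by
        simp only [ENNReal.mul_rpow_of_nonneg _ _ hq.le, ← ENNReal.rpow_mul,
          div_mul_cancel₀ _ hq.ne']
        simp only [lintegral_const_mul _ ((hmeas _).pow_const τ)]
    _ ≤ ∑ _δ : Fin d → Bool,
          K ^ q * (ENNReal.ofReal (τ / (τ - 1)) ^ τ * ∫⁻ x, g x ^ τ ∂weightMeasure w) := by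
        gcongr with δ
        exact hdoob δ
    _ = _ := by simp [Fintype.card_pi]

/-- The function `g` with `|φ| = g ^ (τ / p) * w ^ (1 / p - 1 / q)` almost everywhere; its norm in
`L^τ(w)`, raised to the power `τ`, is the norm of `φ` in `L^p(w^(p/q))`, raised to the power `p`. -/
noncomputable def relativeDensity (p q τ : ℝ) (w φ : (Fin d → ℝ) → ℝ) (x : Fin d → ℝ) : ℝ≥0∞ :=
  (ENNReal.ofReal |φ x| ^ p * ENNReal.ofReal (w x) ^ (p / q - 1)) ^ (1 / τ)

theorem IsWeight.aemeasurable_relativeDensity (hw : IsWeight w) (hφ : AEMeasurable φ) (p q τ : ℝ) :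
    AEMeasurable (relativeDensity p q τ w φ) :=
  (((continuous_abs.measurable.comp_aemeasurable hφ).ennreal_ofReal.pow_const p).mul
    (hw.aemeasurable_ofReal.pow_const _)).pow_const _

theorem IsWeight.ofReal_abs_ae_eq (hw : IsWeight w) {p q τ : ℝ} (hp : 0 < p) (hτ : τ ≠ 0) :
    ∀ᵐ x, ENNReal.ofReal |φ x| =
      relativeDensity p q τ w φ x ^ (τ / p) * ENNReal.ofReal (w x) ^ (1 / p - 1 / q) := by
  filter_upwards [hw.ofReal_ne_zero] with x hx
  have hroot : 1 / τ * (τ / p) = 1 / p := by field_simp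
  have hexp : (p / q - 1) * (1 / p) + (1 / p - 1 / q) = 0 := by field_simp; ring
  rw [relativeDensity, ← ENNReal.rpow_mul, hroot, ENNReal.mul_rpow_of_nonneg _ _ (by positivity),
    ← ENNReal.rpow_mul, ← ENNReal.rpow_mul, mul_assoc, ← ENNReal.rpow_add _ _ hx
    ENNReal.ofReal_ne_top, hexp, mul_one_div_cancel hp.ne', ENNReal.rpow_one, ENNReal.rpow_zero,
    mul_one]

theorem IsWeight.weightedNorm_rpow_weight_eq (hw : IsWeight w) {p q τ : ℝ} (hτ : τ ≠ 0) :
    weightedNorm p (fun x => w x ^ (p / q)) φ =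
      (∫⁻ x, relativeDensity p q τ w φ x ^ τ ∂weightMeasure w) ^ (1 / p) := by
  rw [weightedNorm, hw.lintegral_weightMeasure]
  congr 1
  refine lintegral_congr_ae ?_
  filter_upwards [hw.pos, hw.ofReal_ne_zero] with x hx hx0
  rw [relativeDensity, ← ENNReal.rpow_mul, one_div_mul_cancel hτ, ENNReal.rpow_one, mul_assoc,
    ENNReal.rpow_sub _ _ hx0 ENNReal.ofReal_ne_top, ENNReal.rpow_one,
    ENNReal.div_mul_cancel hx0 ENNReal.ofReal_ne_top, ENNReal.ofReal_rpow_of_pos hx,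
    Real.enorm_eq_ofReal_abs]

theorem IsWeight.weightedNorm_eq_lintegral_weightMeasure (hw : IsWeight w) (q : ℝ)
    (f : (Fin d → ℝ) → ℝ≥0∞) :
    weightedNorm q w f = (∫⁻ x, f x ^ q ∂weightMeasure w) ^ (1 / q) := by
  simp only [weightedNorm, hw.lintegral_weightMeasure, enorm_eq_self]

theorem two_pow_rpow_mul_six_pow_le (d : ℕ) {q : ℝ} (hq : 1 ≤ q) :
    ((2 : ℝ≥0∞) ^ d) ^ (1 / q) * 6 ^ d ≤ 12 ^ d :=
  calc ((2 : ℝ≥0∞) ^ d) ^ (1 / q) * 6 ^ d ≤ ((2 : ℝ≥0∞) ^ d) ^ (1 : ℝ) * 6 ^ d := by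
        gcongr
        · exact one_le_pow₀ one_le_two
        · exact (div_le_one (by linarith)).2 hq
    _ = 12 ^ d := by rw [ENNReal.rpow_one, ← mul_pow]; norm_num

theorem IsWeight.weightedNorm_fracMaximal_le (hw : IsWeight w) (hφ : AEMeasurable φ)
    {α p q r τ : ℝ} (hα : 0 ≤ α / d) (hp : 0 < p) (hq : 0 < q) (hpq : 1 / q = 1 / p - α / d)
    (hr : 1 < r) (hτ : 1 < τ) (hsum : r * (τ / q) + α / d ≤ 1) :
    weightedNorm q w (fracMaximal α φ) ≤
      12 ^ d * (apChar r w ^ (τ / q) * ENNReal.ofReal (τ / (τ - 1)) ^ (τ / q)) *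
        weightedNorm p (fun x => w x ^ (p / q)) φ := by
  have hτ0 : 0 < τ := by linarith
  have hq1 : 1 ≤ q := by
    have hτq : τ / q ≤ 1 := by nlinarith [div_pos hτ0 hq]
    linarith [(div_le_one hq).1 hτq]
  have hdensity : ∀ᵐ x, ENNReal.ofReal |φ x| =
      relativeDensity p q τ w φ x ^ (τ / q + τ * (α / d)) * ENNReal.ofReal (w x) ^ (α / d) := by
    have hexp : τ / q + τ * (α / d) = τ / p := by
      rw [div_eq_mul_one_div τ q, hpq]
      ring
    rw [hexp, show α / d = 1 / p - 1 / q by linarith]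
    exact hw.ofReal_abs_ae_eq hp hτ0.ne'
  have hstrong := hw.lintegral_fracMaximal_rpow_le (hw.aemeasurable_relativeDensity hφ p q τ)
    hdensity hα hq hr hτ hsum
  rw [hw.weightedNorm_eq_lintegral_weightMeasure, hw.weightedNorm_rpow_weight_eq hτ0.ne']
  set G := ∫⁻ x, relativeDensity p q τ w φ x ^ τ ∂weightMeasure w
  have hG : G ^ (α / d) * G ^ (1 / q) = G ^ (1 / p) := by
    rw [← ENNReal.rpow_add_of_nonneg _ _ hα (by positivity), hpq, add_sub_cancel]
  calc (∫⁻ x, fracMaximal α φ x ^ q ∂weightMeasure w) ^ (1 / q)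
      ≤ (2 ^ d * ((6 ^ d * (apChar r w ^ (τ / q) * G ^ (α / d))) ^ q *
          (ENNReal.ofReal (τ / (τ - 1)) ^ τ * G))) ^ (1 / q) := by gcongr
    _ = (2 ^ d) ^ (1 / q) * 6 ^ d *
          (apChar r w ^ (τ / q) * ENNReal.ofReal (τ / (τ - 1)) ^ (τ / q)) *
            (G ^ (α / d) * G ^ (1 / q)) := by
        have hq' : 0 ≤ 1 / q := by positivity
        rw [ENNReal.mul_rpow_of_nonneg _ _ hq', ENNReal.mul_rpow_of_nonneg _ _ hq',
          ENNReal.mul_rpow_of_nonneg _ _ hq', ← ENNReal.rpow_mul _ q, ← ENNReal.rpow_mul _ τ,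
          mul_one_div_cancel hq.ne', ENNReal.rpow_one, mul_one_div]
        ring
    _ ≤ _ := by
        rw [hG]
        gcongr
        exact two_pow_rpow_mul_six_pow_le d hq1

end StrongType

section Exponents

variable {p q r : ℝ}

theorem sub_sExponent (p q r : ℝ) :
    q - sExponent p q r = r * q ^ 2 / ((r - 1) * (q - p) + p * q) :=
  sub_sub_cancel _ _

theorem sExponent_denom_pos (hp : 0 < p) (hq : 0 < q) (hpq : p ≤ q) (hr : 1 < r) :
    0 < (r - 1) * (q - p) + p * q :=
  add_pos_of_nonneg_of_pos (mul_nonneg (sub_nonneg.2 hr.le) (sub_nonneg.2 hpq)) (mul_pos hp hq)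

theorem sExponent_lt (hp : 0 < p) (hq : 0 < q) (hpq : p ≤ q) (hr : 1 < r) :
    sExponent p q r < q := by
  rw [← sub_pos, sub_sExponent]
  exact div_pos (by positivity) (sExponent_denom_pos hp hq hpq hr)

theorem sExponent_pos (hp : 0 < p) (hq : 0 < q) (hpq : p ≤ q) (hr : 1 < r)
    (hr' : (r - 1) * p < q * (p - 1)) : 0 < sExponent p q r := by
  rw [sExponent, sub_pos, div_lt_iff₀ (sExponent_denom_pos hp hq hpq hr), sq, ← mul_assoc,
    mul_comm, mul_lt_mul_iff_right₀ hq]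
  linarith

theorem div_sub_sExponent_add_le_one (hp : 0 < p) (hq : 0 < q) (hpq : p ≤ q) (hr : 1 < r)
    (hr' : (r - 1) * p ≤ q * (p - 1)) :
    r / (q - sExponent p q r) + (1 / p - 1 / q) ≤ 1 := by
  have hslack : 1 - (r / (q - sExponent p q r) + (1 / p - 1 / q)) =
      (q - p) * (q * (p - 1) - (r - 1) * p) / (p * q ^ 2) := by
    rw [sub_sExponent]
    field_simp
    ring
  have hnonneg : 0 ≤ (q - p) * (q * (p - 1) - (r - 1) * p) / (p * q ^ 2) :=
    div_nonneg (mul_nonneg (sub_nonneg.2 hpq) (sub_nonneg.2 hr')) (by positivity)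
  linarith

theorem lt_div_div_add_one_iff (hp : 1 < p) :
    r < q / (p / (p - 1)) + 1 ↔ (r - 1) * p < q * (p - 1) := by
  rw [← sub_lt_iff_lt_add, div_div_eq_mul_div, lt_div_iff₀ (by linarith)]

theorem sExponent_mem_Ioo (hp : 1 < p) (hq : 0 < q) (hpq : p ≤ q)
    (hr : r ∈ Set.Ioo 1 (q / (p / (p - 1)) + 1)) : sExponent p q r ∈ Set.Ioo 0 q := by
  have hp0 : 0 < p := by linarith
  exact ⟨sExponent_pos hp0 hq hpq hr.1 ((lt_div_div_add_one_iff hp).1 hr.2),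
    sExponent_lt hp0 hq hpq hr.1⟩

end Exponents

theorem IsWeight.weightedNorm_fracMaximal_le_of_mem_Ioo {d : ℕ} {α p q r : ℝ}
    {w φ : (Fin d → ℝ) → ℝ} (hw : IsWeight w) (hφ : AEMeasurable φ) (hα : 0 ≤ α / d) (hp : 1 < p)
    (hq : 0 < q) (hpq : 1 / q = 1 / p - α / d)
    (hr : r ∈ Set.Ioo 1 (q / (p / (p - 1)) + 1)) :
    weightedNorm q w (fracMaximal α φ) ≤
      12 ^ d * (apChar r w ^ (1 / (q - sExponent p q r)) *
        ENNReal.ofReal (q / sExponent p q r) ^ (1 / (q - sExponent p q r))) *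
          weightedNorm p (fun x => w x ^ (p / q)) φ := by
  have hp0 : 0 < p := by linarith
  have hle : p ≤ q := (one_div_le_one_div hq hp0).1 (by linarith)
  have hα' : α / d = 1 / p - 1 / q := by linarith
  have hsum := div_sub_sExponent_add_le_one hp0 hq hle hr.1 ((lt_div_div_add_one_iff hp).1 hr.2).le
  obtain ⟨hs, hsq⟩ := sExponent_mem_Ioo hp hq hle hr
  set s := sExponent p q r
  have hqs : 0 < q - s := sub_pos.2 hsq
  have hτq : q / (q - s) / q = 1 / (q - s) := by field_simp
  have hconj : q / (q - s) / (q / (q - s) - 1) = q / s := by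
    rw [div_sub_one hqs.ne', sub_sub_cancel, div_div_div_cancel_right₀ hqs.ne']
  have hbound := hw.weightedNorm_fracMaximal_le hφ hα hp0 hq hpq hr.1
    ((one_lt_div hqs).2 (sub_lt_self q hs)) (by rwa [hτq, mul_one_div, hα'])
  rwa [hτq, hconj] at hbound

theorem le_mul_biInf_mul_of_one_le {ι : Type*} {S : Set ι} (hS : S.Nonempty) {f : ι → ℝ≥0∞}
    (hf : ∀ i ∈ S, 1 ≤ f i) {b c x : ℝ≥0∞} (hx : ∀ i ∈ S, x ≤ b * f i * c) :
    x ≤ b * (⨅ i ∈ S, f i) * c := by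
  have := hS.to_subtype
  have hinf : 1 ≤ ⨅ i : S, f i := le_iInf fun i => hf i i.2
  rw [iInf_subtype', mul_right_comm,
    ENNReal.mul_iInf fun _ h => absurd h (one_pos.trans_le hinf).ne']
  exact le_iInf fun i => (hx i i.2).trans_eq (mul_right_comm _ _ _)

theorem theorem1p1_general (d : ℕ) (α p q : ℝ) (hα : 0 ≤ α) (hαd : α < (d : ℝ))
    (hp : 1 < p) (hq : 0 < q) (hpq : 1 / q = 1 / p - α / (d : ℝ))
    (w : (Fin d → ℝ) → ℝ) (hw : IsWeight w) (φ : (Fin d → ℝ) → ℝ) (hφ : AEMeasurable φ) :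
    weightedNorm q w (fracMaximal α φ) ≤
      (12 : ℝ≥0∞) ^ d *
        (⨅ r ∈ Set.Ioo (1 : ℝ) (q / (p / (p - 1)) + 1),
          apChar r w ^ (1 / (q - sExponent p q r)) *
            ENNReal.ofReal (q / sExponent p q r) ^ (1 / (q - sExponent p q r))) *
        weightedNorm p (fun x => w x ^ (p / q)) φ := by
  have hαd0 : 0 ≤ α / d := div_nonneg hα (hα.trans_lt hαd).le
  have hp0 : 0 < p := by linarith
  have hle : p ≤ q := (one_div_le_one_div hq hp0).1 (by linarith)
  have hrange : (Set.Ioo (1 : ℝ) (q / (p / (p - 1)) + 1)).Nonempty :=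
    Set.nonempty_Ioo.2 (lt_add_of_pos_left 1 (div_pos hq (div_pos hp0 (sub_pos.2 hp))))
  refine le_mul_biInf_mul_of_one_le hrange (fun r hr => ?_) fun r hr =>
    hw.weightedNorm_fracMaximal_le_of_mem_Ioo hφ hαd0 hp hq hpq hr
  obtain ⟨hs, hsq⟩ := sExponent_mem_Ioo hp hq hle hr
  have hexp : 0 < 1 / (q - sExponent p q r) := one_div_pos.2 (sub_pos.2 hsq)
  exact one_le_mul (ENNReal.one_le_rpow (hw.one_le_apChar hr.1) hexp)
    (ENNReal.one_le_rpow (ENNReal.one_le_ofReal.2 ((one_le_div hs).2 hsq.le)) hexp)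

theorem theorem1p1 (d : ℕ) (α p q : ℝ) (hα : 0 ≤ α) (hαd : α < (d : ℝ))
    (hp : 1 < p) (hq : 0 < q) (hpq : 1 / q = 1 / p - α / (d : ℝ))
    (w : (Fin d → ℝ) → ℝ) (hw : IsApWeight (q / (p / (p - 1)) + 1) w)
    (φ : (Fin d → ℝ) → ℝ) (hφ : LocallyIntegrable φ volume) :
    weightedNorm q w (fracMaximal α φ) ≤
      (12 : ℝ≥0∞) ^ d *
        (⨅ r ∈ Set.Ioo (1 : ℝ) (q / (p / (p - 1)) + 1),
          apChar r w ^ (1 / (q - sExponent p q r)) *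
            ENNReal.ofReal (q / sExponent p q r) ^ (1 / (q - sExponent p q r))) *
        weightedNorm p (fun x => w x ^ (p / q)) φ :=
  theorem1p1_general d α p q hα hαd hp hq hpq w hw.1 φ hφ.aestronglyMeasurable.aemeasurable
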